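/- Let $\mathbb{C}^+=\{z\in\mathbb{C}:\operatorname{Im}z>0\}$, let $\varphi:\mathbb{C}^+\to\mathbb{C}^+$ be analytic and let $\alpha\in\mathbb{R}$. Let $(\mu_\alpha,c_\alpha)$ be the Aleksandrov--Clark (AC) pair of $\varphi$ at $\alpha$, that is, $c_\alpha\ge 0$ is a constant and $\mu_\alpha$ is a positive Borel measure on $\mathbb{R}$ with $\int_{\mathbb{R}}\frac{d\mu_\alpha(t)}{1+t^2}<\infty$ such that \[ \frac{1}{\pi(1+\alpha^2)}\operatorname{Re}\left(\frac{i(1+\alpha\varphi(x+iy))}{\varphi(x+iy)-\alpha}\right)=c_\alpha y+\int_{\mathbb{R}}\frac{1}{\pi}\,\frac{y}{(x-t)^2+y^2}\,d\mu_\alpha(t)\qquad(x\in\mathbb{R},\ y>0). \] Then $\mu_\alpha$ has a Lebesgue decomposition $d\mu_\alpha=\mu_\alpha^a\,dm+d\sigma_\alpha$ with respect to Lebesgue measure $m$ on $\mathbb{R}$ (with $\sigma_\alpha\perp m$), and for $m$-almost every $\zeta\in\mathbb{R}$ the finite non-tangential boundary value $\varphi(\zeta)=\lim_{z\to\zeta}\varphi(z)\in\mathbb{C}$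 exists, the density $\mu_\alpha^a(\zeta)$ is finite, and \[ \mu_\alpha^a(\zeta)=\begin{cases}\dfrac{1}{\pi(1+\alpha^2)}\operatorname{Re}\left(\dfrac{i(1+\alpha\varphi(\zeta))}{\varphi(\zeta)-\alpha}\right)&\text{if }\varphi(\zeta)\in\mathbb{C}\setminus\mathbb{R},\\[2ex]0&\text{if }\varphi(\zeta)\in\mathbb{R}.\end{cases} \] -/

import Mathlib

open MeasureTheory Filter Topology Complex

noncomputable section

/-- The Poisson kernel `P_y(s)` of the upper half-plane. -/
def poissonKernelUHP (y s : ℝ) : ℝ := (1 / Real.pi) * (y / (s ^ 2 + y ^ 2))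

/-- The expression `(1 / (π (1 + α²))) Re (i (1 + α w) / (w - α))`, for real `α` and complex `w`. -/
def clarkKernel (α : ℝ) (w : ℂ) : ℝ :=
  (1 / (Real.pi * (1 + α ^ 2))) * (I * (1 + (α : ℂ) * w) / (w - (α : ℂ))).re

/-- `(μ, c)` is the Aleksandrov-Clark pair of `φ` at the real parameter `α`: `c ≥ 0`, `μ` is a
positive Borel measure on `ℝ` with `∫ dμ(t) / (1 + t²) < ∞`, and the positive harmonic function
`clarkKernel α ∘ φ` on the upper half-plane has the Herglotz representation given by `(μ, c)`. -/
structure IsAleksandrovClark (φ : ℂ → ℂ) (α : ℝ) (μ : Measure ℝ) (c : ℝ) : Prop where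
  nonneg : 0 ≤ c
  integrable : Integrable (fun t : ℝ => 1 / (1 + t ^ 2)) μ
  herglotz : ∀ x y : ℝ, 0 < y →
    clarkKernel α (φ ((x : ℂ) + (y : ℂ) * I)) = c * y + ∫ t, poissonKernelUHP y (x - t) ∂μ

/-- The cone of aperture `M` in the upper half-plane with vertex at the real point `x`. -/
def boundaryCone (x M : ℝ) : Set ℂ := {z | 0 < z.im ∧ |z.re - x| < M * z.im}

/-- `w` is the (finite) non-tangential boundary value of `φ` at the real point `x`. -/
def HasNontangentialLimit (φ : ℂ → ℂ) (x : ℝ) (w : ℂ) : Prop :=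
  ∀ M : ℝ, 0 < M → Tendsto φ (𝓝[boundaryCone x M] (x : ℂ)) (𝓝 w)

end

/-! The defining identity has a non-tangential limit on both sides at almost every point, and the
formula compares the two limits. On the right, `c * y` vanishes and the Poisson integral of `μ`
tends to its density (`ae_tendsto_poisson_rnDeriv`). Both the singular part and the error `|u t - u
x| dt` at a Lebesgue point are measures of zero symmetric density, and for these a dyadic estimate
makes the Poisson integral vanish in cones. On the left, `φ` must have a finite limit different from
`α`, where `clarkKernel α` is continuous. Both facts come from
`ae_exists_hasNontangentialLimit_of_re_pos`, applied to `-I * φ` and to `I / (φ - α)`. That lemma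
passes to the Cayley transform, a bounded function that is the Poisson integral of some `u` by weak
compactness in L²; `ae_cayley_boundary_ne_one` excludes the value that corresponds to infinity. -/

/-! ### Bounds for the Poisson kernel -/

lemma poissonKernelUHP_nonneg {y : ℝ} (hy : 0 < y) (s : ℝ) : 0 ≤ poissonKernelUHP y s := by
  unfold poissonKernelUHP; positivity

lemma continuous_poissonKernelUHP {y : ℝ} (hy : 0 < y) (x : ℝ) :
    Continuous fun t : ℝ => poissonKernelUHP y (x - t) := by
  unfold poissonKernelUHP
  refine continuous_const.mul (continuous_const.div (by fun_prop) fun t => ?_)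
  positivity

lemma poissonKernelUHP_le_div {y : ℝ} (hy : 0 < y) (s : ℝ) :
    poissonKernelUHP y s ≤ y / (s ^ 2 + y ^ 2) := by
  unfold poissonKernelUHP
  have h : 1 / Real.pi ≤ 1 := by
    rw [div_le_one Real.pi_pos]; linarith [Real.pi_gt_three]
  calc _ ≤ 1 * (y / (s ^ 2 + y ^ 2)) := by gcongr
    _ = _ := one_mul _

/-- Comparison of the Poisson kernel with the weight `1 / (1 + t²)`. -/
lemma poissonKernelUHP_le_weight {y d : ℝ} (hy : 0 < y) (hd : 0 < d) (x t : ℝ)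
    (h : d ^ 2 ≤ (x - t) ^ 2 + y ^ 2) :
    poissonKernelUHP y (x - t) ≤ y * ((1 + 2 * x ^ 2) / d ^ 2 + 2) * (1 / (1 + t ^ 2)) := by
  refine (poissonKernelUHP_le_div hy _).trans ?_
  rw [mul_one_div, div_le_div_iff₀ (by positivity) (by positivity), mul_assoc]
  refine mul_le_mul_of_nonneg_left ?_ hy.le
  have h1 : 1 + 2 * x ^ 2 ≤ (1 + 2 * x ^ 2) / d ^ 2 * ((x - t) ^ 2 + y ^ 2) := by
    rw [div_mul_eq_mul_div, le_div_iff₀ (by positivity)]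
    gcongr
  -- The first square says `t² ≤ 2x² + 2(x - t)²`.
  nlinarith [sq_nonneg (2 * x - t), sq_nonneg y]

lemma integrable_poissonKernelUHP {ν : Measure ℝ}
    (hν : Integrable (fun t : ℝ => 1 / (1 + t ^ 2)) ν) {y : ℝ} (hy : 0 < y) (x : ℝ) :
    Integrable (fun t => poissonKernelUHP y (x - t)) ν := by
  refine (hν.const_mul (y * ((1 + 2 * x ^ 2) / y ^ 2 + 2))).mono'
    (continuous_poissonKernelUHP hy x).aestronglyMeasurable (ae_of_all _ fun t => ?_)
  rw [Real.norm_of_nonneg (poissonKernelUHP_nonneg hy _)]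
  exact poissonKernelUHP_le_weight hy hy x t (by nlinarith [sq_nonneg (x - t)])

/-- Inside a cone, the Poisson kernel is controlled by the one centred at the vertex. -/
lemma poissonKernelUHP_le_of_mem_boundaryCone {x M : ℝ} {z : ℂ} (hz : z ∈ boundaryCone x M)
    (t : ℝ) : poissonKernelUHP z.im (z.re - t) ≤
      (2 + 2 * M ^ 2) * poissonKernelUHP z.im (x - t) := by
  obtain ⟨hy, hx⟩ := hz
  unfold poissonKernelUHP
  rw [← mul_assoc, mul_comm (2 + 2 * M ^ 2), mul_assoc]
  refine mul_le_mul_of_nonneg_left ?_ (by positivity)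
  rw [← mul_div_assoc, div_le_div_iff₀ (by positivity) (by positivity), mul_comm _ z.im,
    mul_assoc z.im]
  refine mul_le_mul_of_nonneg_left ?_ hy.le
  have h2 : (z.re - x) ^ 2 ≤ M ^ 2 * z.im ^ 2 := by
    rw [← mul_pow, ← sq_abs (z.re - x)]
    gcongr
  nlinarith [sq_nonneg ((z.re - t) + (z.re - x)), sq_nonneg (M * (z.re - t)), sq_nonneg (z.re - t),
    sq_nonneg M, sq_nonneg z.im]

/-! ### Poisson integrals at points of zero density -/

/-- Dyadic majorant of the Poisson kernel. -/
lemma poissonKernelUHP_le_tsum {y : ℝ} (hy : 0 < y) (x t : ℝ) :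
    ENNReal.ofReal (poissonKernelUHP y (x - t)) ≤
      ∑' k : ℕ, (Metric.closedBall x (2 ^ k * y)).indicator
        (fun _ => ENNReal.ofReal (4 / 4 ^ k / y)) t := by
  have hex : ∃ k : ℕ, |x - t| ≤ 2 ^ k * y := by
    obtain ⟨k, hk⟩ := pow_unbounded_of_one_lt (|x - t| / y) (one_lt_two (α := ℝ))
    exact ⟨k, ((div_lt_iff₀ hy).1 hk).le⟩
  classical
  -- One term suffices: the least `k` with `|x - t| ≤ 2 ^ k * y`. For `k > 0`, minimality bounds `|x
  -- - t|` below by half that radius.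
  refine le_trans ?_ (ENNReal.le_tsum (Nat.find hex))
  have hm : t ∈ Metric.closedBall x (2 ^ (Nat.find hex) * y) := by
    rw [Metric.mem_closedBall, dist_comm, Real.dist_eq]
    exact Nat.find_spec hex
  rw [Set.indicator_of_mem hm]
  refine ENNReal.ofReal_le_ofReal ((poissonKernelUHP_le_div hy _).trans ?_)
  rcases hk : Nat.find hex with _ | k
  · rw [div_le_div_iff₀ (by positivity) hy]
    nlinarith [sq_nonneg (x - t), sq_nonneg y]
  · have h1 : 2 ^ k * y < |x - t| := not_le.1 (Nat.find_min hex (m := k) (by omega))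
    have h2 : 4 ^ k * y ^ 2 ≤ (x - t) ^ 2 := by
      have : (2 ^ k * y) ^ 2 ≤ |x - t| ^ 2 := by gcongr
      rw [sq_abs, mul_pow, ← pow_mul, mul_comm k, pow_mul] at this
      norm_num at this; exact this
    have h3 : (4 : ℝ) / 4 ^ (k + 1) / y = 1 / (4 ^ k * y) := by
      rw [pow_succ]; field_simp
    rw [h3, div_le_div_iff₀ (by positivity) (by positivity)]
    nlinarith [sq_nonneg y]

/-- A measure of zero symmetric density at `x` has vanishing Poisson integral over a small interval
around `x`, uniformly in the height. -/
lemma setLIntegral_poissonKernelUHP_le {ν : Measure ℝ} {x ε δ : ℝ} (hε : 0 ≤ ε) (hδ : 0 < δ)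
    (hν : ∀ r, 0 < r → r ≤ δ → ν (Metric.closedBall x r) ≤ ENNReal.ofReal (ε * r))
    {y : ℝ} (hy : 0 < y) :
    ∫⁻ t in Metric.closedBall x δ, ENNReal.ofReal (poissonKernelUHP y (x - t)) ∂ν ≤
      ENNReal.ofReal (8 * ε) := by
  have hball : ∀ k : ℕ, ν (Metric.closedBall x (2 ^ k * y) ∩ Metric.closedBall x δ) ≤
      ENNReal.ofReal (ε * (2 ^ k * y)) := by
    intro k
    rcases le_total (2 ^ k * y) δ with h | h
    · exact (measure_mono Set.inter_subset_left).trans (hν _ (by positivity) h)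
    · refine (measure_mono Set.inter_subset_right).trans ((hν _ hδ le_rfl).trans ?_)
      exact ENNReal.ofReal_le_ofReal (by gcongr)
  calc _ ≤ ∫⁻ t in Metric.closedBall x δ, ∑' k : ℕ, (Metric.closedBall x (2 ^ k * y)).indicator
        (fun _ => ENNReal.ofReal (4 / 4 ^ k / y)) t ∂ν :=
        lintegral_mono fun t => poissonKernelUHP_le_tsum hy x t
    _ = ∑' k : ℕ, ENNReal.ofReal (4 / 4 ^ k / y) *
        ν (Metric.closedBall x (2 ^ k * y) ∩ Metric.closedBall x δ) := by
        rw [lintegral_tsum fun k =>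
          (measurable_const.indicator Metric.isClosed_closedBall.measurableSet).aemeasurable]
        congr 1 with k
        rw [lintegral_indicator_const Metric.isClosed_closedBall.measurableSet,
          Measure.restrict_apply Metric.isClosed_closedBall.measurableSet]
    _ ≤ ∑' k : ℕ, ENNReal.ofReal (4 * ε * (1 / 2) ^ k) := by
        refine ENNReal.tsum_le_tsum fun k => ?_
        refine (mul_le_mul_right (hball k) _).trans ?_
        rw [← ENNReal.ofReal_mul (by positivity)]
        refine ENNReal.ofReal_le_ofReal (le_of_eq ?_)
        have : (4 : ℝ) ^ k = 2 ^ k * 2 ^ k := by rw [← mul_pow]; norm_num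
        rw [this, one_div, inv_pow]
        field_simp
    _ = ENNReal.ofReal (8 * ε) := by
        rw [← ENNReal.ofReal_tsum_of_nonneg (fun k => by positivity)
          (summable_geometric_two.mul_left _), tsum_mul_left, tsum_geometric_two]
        congr 1; ring

/-- At a point of zero symmetric density, the Poisson integral tends to zero. -/
lemma tendsto_lintegral_poissonKernelUHP_of_density_zero {ν : Measure ℝ} {x : ℝ}
    (hfin : ∫⁻ t, ENNReal.ofReal (1 / (1 + t ^ 2)) ∂ν ≠ ⊤)
    (hν : Tendsto (fun r => ν (Metric.closedBall x r) / volume (Metric.closedBall x r))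
      (𝓝[>] 0) (𝓝 0)) :
    Tendsto (fun y => ∫⁻ t, ENNReal.ofReal (poissonKernelUHP y (x - t)) ∂ν) (𝓝[>] 0) (𝓝 0) := by
  rw [ENNReal.tendsto_nhds_zero]
  intro η hη
  -- The ball of radius `δ` contributes `8 * ε`, its complement `ε`.
  obtain ⟨ε, hε, hεη⟩ : ∃ ε : ℝ, 0 < ε ∧ ENNReal.ofReal (9 * ε) ≤ η := by
    rcases eq_or_ne η ⊤ with rfl | h
    · exact ⟨1, one_pos, le_top⟩
    · refine ⟨η.toReal / 9, by have := ENNReal.toReal_pos hη.ne' h; positivity, ?_⟩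
      rw [mul_div_cancel₀ _ (by norm_num), ENNReal.ofReal_toReal h]
  obtain ⟨δ, hδ, hball⟩ : ∃ δ > 0, ∀ r, 0 < r → r ≤ δ →
      ν (Metric.closedBall x r) ≤ ENNReal.ofReal (ε * r) := by
    have h1 := (ENNReal.tendsto_nhds_zero.1 hν) (ENNReal.ofReal (ε / 2))
      (ENNReal.ofReal_pos.2 (by positivity))
    obtain ⟨δ, hδ, h2⟩ := mem_nhdsGT_iff_exists_Ioc_subset.1 h1
    refine ⟨δ, hδ, fun r hr hrδ => ?_⟩
    have h3 : ν (Metric.closedBall x r) / volume (Metric.closedBall x r) ≤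
      ENNReal.ofReal (ε / 2) := h2 ⟨hr, hrδ⟩
    rw [Real.volume_closedBall, ENNReal.div_le_iff (by simpa using hr) ENNReal.ofReal_ne_top,
      ← ENNReal.ofReal_mul (by positivity)] at h3
    refine h3.trans (le_of_eq ?_)
    congr 1; ring
  set A := ∫⁻ t, ENNReal.ofReal (1 / (1 + t ^ 2)) ∂ν with hA
  have hlim : Tendsto (fun y : ℝ => ENNReal.ofReal (y * ((1 + 2 * x ^ 2) / δ ^ 2 + 2)) * A)
      (𝓝[>] 0) (𝓝 0) := by
    have h1 : Tendsto (fun y : ℝ => y * ((1 + 2 * x ^ 2) / δ ^ 2 + 2)) (𝓝[>] 0) (𝓝 0) := by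
      refine Tendsto.mono_left ?_ nhdsWithin_le_nhds
      exact Continuous.tendsto' (by fun_prop) _ _ (by simp)
    have h2 := ENNReal.Tendsto.mul_const (ENNReal.tendsto_ofReal h1) (Or.inr hfin)
    simpa using h2
  filter_upwards [(ENNReal.tendsto_nhds_zero.1 hlim) (ENNReal.ofReal ε) (ENNReal.ofReal_pos.2 hε),
    self_mem_nhdsWithin] with y hyA hy
  rw [Set.mem_Ioi] at hy
  rw [← lintegral_add_compl _ (Metric.isClosed_closedBall (x := x) (ε := δ)).measurableSet]
  calc _ ≤ ENNReal.ofReal (8 * ε) + ENNReal.ofReal ε := by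
        refine add_le_add (setLIntegral_poissonKernelUHP_le hε.le hδ hball hy) (le_trans ?_ hyA)
        rw [hA, ← lintegral_const_mul' _ _ ENNReal.ofReal_ne_top]
        refine (setLIntegral_mono' Metric.isClosed_closedBall.measurableSet.compl
          fun t ht => ?_).trans (setLIntegral_le_lintegral _ _)
        rw [← ENNReal.ofReal_mul (by positivity)]
        refine ENNReal.ofReal_le_ofReal (poissonKernelUHP_le_weight hy hδ x t ?_)
        rw [Set.mem_compl_iff, Metric.mem_closedBall, dist_comm, Real.dist_eq, not_le] at ht
        have : δ ^ 2 ≤ |x - t| ^ 2 := by gcongr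
        rw [sq_abs] at this
        nlinarith [sq_nonneg y]
    _ = ENNReal.ofReal (9 * ε) := by
        rw [← ENNReal.ofReal_add (by positivity) hε.le]; congr 1; ring
    _ ≤ η := hεη

lemma integral_poissonKernelUHP {y : ℝ} (hy : 0 < y) (x : ℝ) :
    ∫ t, poissonKernelUHP y (x - t) = 1 := by
  rw [integral_sub_left_eq_self (poissonKernelUHP y) volume x]
  have h : ∀ s, poissonKernelUHP y s = (1 / Real.pi * (1 / y)) * (1 + (s / y) ^ 2)⁻¹ := by
    intro s
    unfold poissonKernelUHP
    field_simp
    ring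
  simp_rw [h]
  rw [integral_const_mul, Measure.integral_comp_div (fun v => (1 + v ^ 2)⁻¹) y,
    integral_univ_inv_one_add_sq, abs_of_pos hy, smul_eq_mul]
  have := Real.pi_pos
  field_simp

lemma integrable_one_div_one_add_sq : Integrable (fun t : ℝ => 1 / (1 + t ^ 2)) volume := by
  simpa [one_div] using integrable_inv_one_add_sq

lemma lintegral_weight_ne_top {ν : Measure ℝ} (hν : Integrable (fun t : ℝ => 1 / (1 + t ^ 2)) ν) :
    ∫⁻ t, ENNReal.ofReal (1 / (1 + t ^ 2)) ∂ν ≠ ⊤ := by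
  refine ((hasFiniteIntegral_iff_ofReal (ae_of_all _ fun t => ?_)).1 hν.2).ne
  positivity

/-- Multiplying the integrable weight by the continuous function `1 + t²` makes the constant 1
locally integrable. Local finiteness is what the differentiation theorem and the Lebesgue
decomposition require. -/
lemma isLocallyFiniteMeasure_of_integrable_weight {ν : Measure ℝ}
    (hν : Integrable (fun t : ℝ => 1 / (1 + t ^ 2)) ν) : IsLocallyFiniteMeasure ν := by
  refine ⟨fun x => ?_⟩
  have h : LocallyIntegrable (fun t : ℝ => (1 / (1 + t ^ 2)) • (1 + t ^ 2)) ν :=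
    hν.locallyIntegrable.smul_continuous (by fun_prop)
  have h1 : (fun t : ℝ => (1 / (1 + t ^ 2)) • (1 + t ^ 2)) = fun _ => (1 : ℝ) := by
    ext t
    have : (1 + t ^ 2 : ℝ) ≠ 0 := by positivity
    simp [this]
  rw [h1] at h
  obtain ⟨U, hU, hint⟩ := h x
  refine ⟨U, hU, ?_⟩
  rcases (integrableOn_const_iff (by simp)).1 hint with h | h
  · norm_num at h
  · exact h

/-- At a point of zero symmetric density, the Poisson integral tends to zero
non-tangentially. -/
lemma tendsto_lintegral_poissonKernelUHP_cone {ν : Measure ℝ} {x : ℝ}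
    (hfin : ∫⁻ t, ENNReal.ofReal (1 / (1 + t ^ 2)) ∂ν ≠ ⊤)
    (hν : Tendsto (fun r => ν (Metric.closedBall x r) / volume (Metric.closedBall x r))
      (𝓝[>] 0) (𝓝 0)) (M : ℝ) :
    Tendsto (fun z : ℂ => ∫⁻ t, ENNReal.ofReal (poissonKernelUHP z.im (z.re - t)) ∂ν)
      (𝓝[boundaryCone x M] (x : ℂ)) (𝓝 0) := by
  have him : Tendsto Complex.im (𝓝[boundaryCone x M] (x : ℂ)) (𝓝[>] 0) := by
    refine tendsto_nhdsWithin_iff.2 ⟨?_, ?_⟩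
    · exact (continuous_im.tendsto' _ _ (ofReal_im x)).mono_left nhdsWithin_le_nhds
    · filter_upwards [self_mem_nhdsWithin] with z hz using hz.1
  have h := ENNReal.Tendsto.const_mul (a := ENNReal.ofReal (2 + 2 * M ^ 2))
    ((tendsto_lintegral_poissonKernelUHP_of_density_zero hfin hν).comp him)
    (Or.inr ENNReal.ofReal_ne_top)
  rw [mul_zero] at h
  refine tendsto_of_tendsto_of_tendsto_of_le_of_le' tendsto_const_nhds h
    (Eventually.of_forall fun _ => zero_le) ?_
  filter_upwards [self_mem_nhdsWithin] with z hz
  rw [Function.comp_apply, ← lintegral_const_mul' _ _ ENNReal.ofReal_ne_top]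
  refine lintegral_mono fun t => ?_
  rw [← ENNReal.ofReal_mul (by positivity)]
  exact ENNReal.ofReal_le_ofReal (poissonKernelUHP_le_of_mem_boundaryCone hz t)

/-! ### Fatou's theorem for measures and densities -/

/-- The Poisson integral of a singular measure has non-tangential limit zero almost everywhere. -/
lemma ae_tendsto_poisson_of_mutuallySingular {σ : Measure ℝ}
    (hσ : Integrable (fun t : ℝ => 1 / (1 + t ^ 2)) σ) (hs : σ ⟂ₘ volume) :
    ∀ᵐ x : ℝ, ∀ M : ℝ, Tendsto (fun z : ℂ => ∫ t, poissonKernelUHP z.im (z.re - t) ∂σ)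
      (𝓝[boundaryCone x M] (x : ℂ)) (𝓝 0) := by
  have := isLocallyFiniteMeasure_of_integrable_weight hσ
  filter_upwards [(Besicovitch.vitaliFamily
    (volume : Measure ℝ)).ae_eventually_measure_zero_of_singular hs] with x hx M
  have h := tendsto_lintegral_poissonKernelUHP_cone (lintegral_weight_ne_top hσ)
    (hx.comp (Besicovitch.tendsto_filterAt volume x)) M
  rw [← ENNReal.toReal_zero]
  refine ((ENNReal.tendsto_toReal ENNReal.zero_ne_top).comp h).congr' ?_
  filter_upwards [self_mem_nhdsWithin] with z hz
  rw [Function.comp_apply, integral_eq_lintegral_of_nonneg_ae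
    (ae_of_all _ fun t => poissonKernelUHP_nonneg hz.1 _)
    (continuous_poissonKernelUHP hz.1 _).aestronglyMeasurable]

section Density

variable {E : Type*} [NormedAddCommGroup E] [NormedSpace ℝ E]

lemma aestronglyMeasurable_of_integrable_weight_smul {u : ℝ → E}
    (hu : Integrable (fun t : ℝ => (1 / (1 + t ^ 2)) • u t)) : AEStronglyMeasurable u := by
  have h : AEStronglyMeasurable (fun t : ℝ => (1 + t ^ 2) • (1 / (1 + t ^ 2)) • u t) :=
    (by fun_prop : Continuous fun t : ℝ => 1 + t ^ 2).aestronglyMeasurable.smul hu.1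
  refine h.congr (ae_of_all _ fun t => ?_)
  have : (1 + t ^ 2 : ℝ) ≠ 0 := by positivity
  simp [smul_smul, this]

lemma locallyIntegrable_of_integrable_weight_smul {u : ℝ → E}
    (hu : Integrable (fun t : ℝ => (1 / (1 + t ^ 2)) • u t)) : LocallyIntegrable u := by
  have h := (locallyIntegrableOn_univ.2 hu.locallyIntegrable).continuousOn_smul
    isOpen_univ.isLocallyClosed
    (by fun_prop : Continuous fun t : ℝ => 1 + t ^ 2).continuousOn
  rw [locallyIntegrableOn_univ] at h
  refine h.congr (ae_of_all _ fun t => ?_)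
  have : (1 + t ^ 2 : ℝ) ≠ 0 := by positivity
  simp [smul_smul, this]

lemma integrable_poissonKernelUHP_smul {u : ℝ → E}
    (hu : Integrable (fun t : ℝ => (1 / (1 + t ^ 2)) • u t)) {y : ℝ} (hy : 0 < y) (x : ℝ) :
    Integrable (fun t => poissonKernelUHP y (x - t) • u t) := by
  refine (hu.norm.const_mul (y * ((1 + 2 * x ^ 2) / y ^ 2 + 2))).mono'
    ((continuous_poissonKernelUHP hy x).aestronglyMeasurable.smul
      (aestronglyMeasurable_of_integrable_weight_smul hu)) (ae_of_all _ fun t => ?_)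
  rw [norm_smul, norm_smul, ← mul_assoc, Real.norm_of_nonneg (poissonKernelUHP_nonneg hy _),
    Real.norm_of_nonneg (by positivity : (0 : ℝ) ≤ 1 / (1 + t ^ 2))]
  refine mul_le_mul_of_nonneg_right ?_ (norm_nonneg _)
  exact poissonKernelUHP_le_weight hy hy x t (by nlinarith [sq_nonneg (x - t)])

/-- **Fatou's theorem** for Poisson integrals of functions on the upper half-plane. -/
lemma ae_tendsto_poisson_smul [CompleteSpace E] {u : ℝ → E}
    (hu : Integrable (fun t : ℝ => (1 / (1 + t ^ 2)) • u t)) :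
    ∀ᵐ x : ℝ, ∀ M : ℝ, Tendsto (fun z : ℂ => ∫ t, poissonKernelUHP z.im (z.re - t) • u t)
      (𝓝[boundaryCone x M] (x : ℂ)) (𝓝 (u x)) := by
  have hloc := locallyIntegrable_of_integrable_weight_smul hu
  have hmeas := aestronglyMeasurable_of_integrable_weight_smul hu
  filter_upwards [(Besicovitch.vitaliFamily
    (volume : Measure ℝ)).ae_tendsto_lintegral_enorm_sub_div hloc] with x hx M
  have hme : AEMeasurable (fun t => ‖u t - u x‖ₑ) :=
    (hmeas.sub aestronglyMeasurable_const).enorm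
  have hw : Integrable (fun t : ℝ => (1 / (1 + t ^ 2)) • (u t - u x)) := by
    simp_rw [smul_sub]
    exact hu.sub (integrable_one_div_one_add_sq.smul_const _)
  have hlint : ∀ g : ℝ → ℝ, Measurable g → (∀ t, 0 ≤ g t) →
      ∫⁻ t, ENNReal.ofReal (g t) ∂(volume.withDensity fun t => ‖u t - u x‖ₑ) =
        ∫⁻ t, ‖g t • (u t - u x)‖ₑ := by
    intro g hg hg0
    rw [lintegral_withDensity_eq_lintegral_mul₀ hme hg.ennreal_ofReal.aemeasurable]
    congr 1 with t
    rw [Pi.mul_apply, mul_comm, enorm_smul, Real.enorm_of_nonneg (hg0 t)]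
  -- At a Lebesgue point `x` the measure `|u t - u x| dt` has zero density; since the kernel has
  -- mass one, its Poisson integral dominates the error.
  have h := tendsto_lintegral_poissonKernelUHP_cone (x := x)
    (ν := volume.withDensity fun t => ‖u t - u x‖ₑ) ?_ ?_ M
  · rw [tendsto_iff_edist_tendsto_0]
    refine tendsto_of_tendsto_of_tendsto_of_le_of_le' tendsto_const_nhds h
      (Eventually.of_forall fun _ => zero_le) ?_
    filter_upwards [self_mem_nhdsWithin] with z hz
    have hc := continuous_poissonKernelUHP hz.1 z.re
    rw [hlint _ hc.measurable fun t => poissonKernelUHP_nonneg hz.1 _]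
    refine le_trans (le_of_eq ?_) (enorm_integral_le_lintegral_enorm _)
    simp_rw [smul_sub]
    rw [integral_sub (integrable_poissonKernelUHP_smul hu hz.1 _)
      ((integrable_poissonKernelUHP integrable_one_div_one_add_sq hz.1 _).smul_const _),
      integral_smul_const, integral_poissonKernelUHP hz.1, one_smul, edist_eq_enorm_sub]
  · rw [hlint _ (by fun_prop) fun t => by positivity]
    exact hw.2.ne
  · refine (hx.comp (Besicovitch.tendsto_filterAt volume x)).congr fun r => ?_
    rw [Function.comp_apply, withDensity_apply _ Metric.isClosed_closedBall.measurableSet]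

end Density

/-- **Fatou's theorem** for Poisson integrals of positive measures on the upper half-plane. -/
lemma ae_tendsto_poisson_rnDeriv {μ : Measure ℝ}
    (hμ : Integrable (fun t : ℝ => 1 / (1 + t ^ 2)) μ) :
    ∀ᵐ x : ℝ, ∀ M : ℝ, Tendsto (fun z : ℂ => ∫ t, poissonKernelUHP z.im (z.re - t) ∂μ)
      (𝓝[boundaryCone x M] (x : ℂ)) (𝓝 (μ.rnDeriv volume x).toReal) := by
  have := isLocallyFiniteMeasure_of_integrable_weight hμ
  have hadd := μ.haveLebesgueDecomposition_add volume
  have hs : Integrable (fun t : ℝ => 1 / (1 + t ^ 2)) (μ.singularPart volume) :=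
    hμ.mono_measure (Measure.singularPart_le _ _)
  have hd : Integrable (fun t : ℝ => 1 / (1 + t ^ 2))
      (volume.withDensity (μ.rnDeriv volume)) :=
    hμ.mono_measure (Measure.withDensity_rnDeriv_le _ _)
  have hm : AEMeasurable (μ.rnDeriv volume) := (Measure.measurable_rnDeriv _ _).aemeasurable
  have hlt := Measure.rnDeriv_lt_top μ volume
  have hu : Integrable (fun t : ℝ => (1 / (1 + t ^ 2)) • (μ.rnDeriv volume t).toReal) := by
    refine ((integrable_withDensity_iff_integrable_smul₀' hm hlt).1 hd).congr
      (ae_of_all _ fun t => ?_)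
    simp only [smul_eq_mul, mul_comm]
  filter_upwards [ae_tendsto_poisson_of_mutuallySingular hs
    (Measure.mutuallySingular_singularPart _ _), ae_tendsto_poisson_smul hu] with x h1 h2 M
  have h3 := (h1 M).add (h2 M)
  rw [zero_add] at h3
  refine h3.congr' ?_
  filter_upwards [self_mem_nhdsWithin] with z hz
  conv_rhs => rw [hadd]
  rw [integral_add_measure (integrable_poissonKernelUHP hs hz.1 _)
    (integrable_poissonKernelUHP hd hz.1 _), integral_withDensity_eq_integral_toReal_smul₀ hm hlt]
  simp only [smul_eq_mul, mul_comm]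

/-! ### Poisson formula for bounded holomorphic functions -/

/-- A function holomorphic on the closed upper half-plane which is `O(|z|⁻²)` at infinity has
vanishing integral over the real line. -/
lemma integral_real_eq_zero_of_decay {G : ℂ → ℂ} (hG : DifferentiableOn ℂ G {z | 0 ≤ z.im})
    (hint : Integrable fun t : ℝ => G t) {C R₀ : ℝ}
    (hdecay : ∀ z : ℂ, 0 ≤ z.im → R₀ ≤ ‖z‖ → ‖G z‖ ≤ C / ‖z‖ ^ 2) :
    ∫ t : ℝ, G t = 0 := by
  have hlim := intervalIntegral_tendsto_integral hint tendsto_neg_atTop_atBot tendsto_id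
  -- Cauchy on the rectangle `[-R, R] × [0, R]`: the three non-real sides have total length `4R`,
  -- and there `‖G‖ ≤ |C| / R²`.
  refine tendsto_nhds_unique hlim (squeeze_zero_norm' (a := fun R : ℝ => 4 * |C| / R) ?_ ?_)
  · filter_upwards [eventually_ge_atTop R₀, eventually_gt_atTop 0] with R hR hR0
    have hrect := integral_boundary_rect_eq_zero_of_differentiableOn G (-R : ℝ) (R + R * I)
      (hG.mono fun z hz => by
        rw [mem_reProdIm] at hz
        have := hz.2
        simp only [ofReal_im, add_im, mul_im, ofReal_re, I_im, mul_one, I_re, mul_zero,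
          add_zero, zero_add, Set.uIcc_of_le hR0.le] at this
        exact this.1)
    simp only [ofReal_re, ofReal_im, add_re, add_im, mul_re, mul_im, I_re, I_im, mul_zero, mul_one,
      add_zero, zero_add, ofReal_zero, zero_mul, smul_eq_mul, sub_self] at hrect
    have key : ∀ z : ℂ, 0 ≤ z.im → R ≤ ‖z‖ → ‖G z‖ ≤ |C| / R ^ 2 := fun z hz hRz =>
      (hdecay z hz (hR.trans hRz)).trans (by gcongr; exact le_abs_self C)
    have h1 : ‖∫ x in -R..R, G (x + R * I)‖ ≤ |C| / R ^ 2 * |R - -R| := by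
      refine intervalIntegral.norm_integral_le_of_norm_le_const fun x _ => key _ ?_ ?_
      · simp [hR0.le]
      · simpa [abs_of_pos hR0] using abs_im_le_norm (x + R * I : ℂ)
    have h2 : ‖∫ y in (0 : ℝ)..R, G (R + y * I)‖ ≤ |C| / R ^ 2 * |R - 0| := by
      refine intervalIntegral.norm_integral_le_of_norm_le_const fun y hy => key _ ?_ ?_
      · rw [Set.uIoc_of_le hR0.le] at hy; simpa using hy.1.le
      · simpa [abs_of_pos hR0] using abs_re_le_norm (R + y * I : ℂ)
    have h3 : ‖∫ y in (0 : ℝ)..R, G ((-R : ℝ) + y * I)‖ ≤ |C| / R ^ 2 * |R - 0| := by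
      refine intervalIntegral.norm_integral_le_of_norm_le_const fun y hy => key _ ?_ ?_
      · rw [Set.uIoc_of_le hR0.le] at hy; simpa using hy.1.le
      · simpa [abs_of_pos hR0] using abs_re_le_norm ((-R : ℝ) + y * I : ℂ)
    have h4 : ∫ x in -R..R, G x = (∫ x in -R..R, G (x + R * I)) -
        I * (∫ y in (0 : ℝ)..R, G (R + y * I)) +
        I * (∫ y in (0 : ℝ)..R, G ((-R : ℝ) + y * I)) := by
      linear_combination hrect
    rw [id_eq, h4]
    refine (norm_add_le _ _).trans ((add_le_add (norm_sub_le _ _) le_rfl).trans ?_)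
    rw [norm_mul, norm_mul, norm_I, one_mul, one_mul]
    rw [sub_neg_eq_add, abs_of_pos (by linarith : 0 < R + R)] at h1
    rw [sub_zero, abs_of_pos hR0] at h2 h3
    refine (add_le_add (add_le_add h1 h2) h3).trans (le_of_eq ?_)
    field_simp
    ring
  · exact tendsto_const_nhds.div_atTop tendsto_id

lemma integrable_weight_smul_of_bounded {E : Type*} [NormedAddCommGroup E] [NormedSpace ℝ E]
    {u : ℝ → E} (hu : AEStronglyMeasurable u) {K : ℝ}
    (hK : ∀ t, ‖u t‖ ≤ K) : Integrable fun t : ℝ => (1 / (1 + t ^ 2)) • u t := by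
  refine (integrable_one_div_one_add_sq.mul_const K).mono'
    (integrable_one_div_one_add_sq.1.smul hu) (ae_of_all _ fun t => ?_)
  rw [norm_smul, Real.norm_of_nonneg (by positivity)]
  exact mul_le_mul_of_nonneg_left (hK t) (by positivity)

/-- The Poisson formula for bounded functions holomorphic in a neighbourhood of the closed upper
half-plane. -/
lemma integral_poissonKernelUHP_smul_of_bounded {f : ℂ → ℂ} {U : Set ℂ} (hU : IsOpen U)
    (hsub : {z : ℂ | 0 ≤ z.im} ⊆ U) (hf : DifferentiableOn ℂ f U) {K : ℝ}
    (hK : ∀ z : ℂ, 0 ≤ z.im → ‖f z‖ ≤ K) {z : ℂ} (hz : 0 < z.im) :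
    ∫ t : ℝ, poissonKernelUHP z.im (z.re - t) • f t = f z := by
  have hcont : Continuous fun t : ℝ => f t :=
    continuousOn_univ.1 (hf.continuousOn.comp continuous_ofReal.continuousOn
      fun t _ => hsub (by simp))
  have hPf := integrable_poissonKernelUHP_smul (integrable_weight_smul_of_bounded
    hcont.aestronglyMeasurable fun t => hK t (by simp)) hz z.re
  have hPc := (integrable_poissonKernelUHP integrable_one_div_one_add_sq hz z.re).smul_const (f z)
  have hP : Integrable fun t : ℝ => poissonKernelUHP z.im (z.re - t) • (f t - f z) := by
    simp_rw [smul_sub]; exact hPf.sub hPc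
  -- Off `z` this is `(f ζ - f z) / ((ζ - z)(ζ - z̄))`, with the singularity at `z` removed by
  -- `dslope`. On the real line it is `π / z.im` times the Poisson kernel times `f t - f z`.
  set G : ℂ → ℂ := fun ζ => dslope f z ζ * (1 / (ζ - (starRingEnd ℂ) z)) with hGdef
  have hne : ∀ ζ : ℂ, 0 ≤ ζ.im → ζ - (starRingEnd ℂ) z ≠ 0 := by
    intro ζ hζ h
    have := congrArg Complex.im h
    simp only [sub_im, conj_im, zero_im] at this
    linarith
  have hG : DifferentiableOn ℂ G {z | 0 ≤ z.im} := by
    refine (((differentiableOn_dslope (hU.mem_nhds (hsub hz.le))).2 hf).mono hsub).mul ?_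
    refine (differentiableOn_const _).div (by fun_prop) fun ζ hζ => hne ζ hζ
  have hGt : ∀ t : ℝ, G t = ((Real.pi / z.im : ℝ) : ℂ) *
      (poissonKernelUHP z.im (z.re - t) • (f t - f z)) := by
    intro t
    have htz : (t : ℂ) ≠ z := fun h => by rw [← h, ofReal_im] at hz; exact lt_irrefl _ hz
    have hprod : ((t : ℂ) - z) * (t - (starRingEnd ℂ) z) =
        (((z.re - t) ^ 2 + z.im ^ 2 : ℝ) : ℂ) := by
      apply Complex.ext <;> simp [pow_two] <;> ring
    have hpos : (((z.re - t) ^ 2 + z.im ^ 2 : ℝ) : ℂ) ≠ 0 := by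
      rw [ofReal_ne_zero]; positivity
    have hscal : Real.pi / z.im * poissonKernelUHP z.im (z.re - t) =
        1 / ((z.re - t) ^ 2 + z.im ^ 2) := by
      have := Real.pi_pos
      unfold poissonKernelUHP
      field_simp
    rw [hGdef, real_smul, ← mul_assoc, ← ofReal_mul, hscal]
    simp only [dslope_of_ne _ htz, slope_def_field]
    rw [div_mul_div_comm, mul_one, hprod, ofReal_div, ofReal_one]
    ring
  have hK0 : 0 ≤ K := (norm_nonneg _).trans (hK z hz.le)
  have hzero := integral_real_eq_zero_of_decay hG
    ((hP.const_mul ((Real.pi / z.im : ℝ) : ℂ)).congr (ae_of_all _ fun t => (hGt t).symm))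
    -- For `‖ζ‖ ≥ 2‖z‖` both denominators are at least `‖ζ‖ / 2`, and the numerator is at most `2K`.
    (C := 8 * K) (R₀ := 2 * ‖z‖) (fun ζ hζ hR => by
      have hz0 : 0 < ‖z‖ := norm_pos_iff.2 fun h => by rw [h] at hz; exact lt_irrefl _ hz
      have hζ0 : 0 < ‖ζ‖ := by linarith
      have h1 : ‖ζ‖ / 2 ≤ ‖ζ - z‖ := by linarith [norm_sub_norm_le ζ z]
      have h2 : ‖ζ‖ / 2 ≤ ‖ζ - (starRingEnd ℂ) z‖ := by
        have := norm_sub_norm_le ζ ((starRingEnd ℂ) z)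
        rw [RCLike.norm_conj] at this
        linarith
      have hζz : ζ ≠ z := fun h => by rw [h] at hR; linarith
      rw [hGdef]
      simp only [dslope_of_ne _ hζz, slope_def_field]
      rw [div_mul_div_comm, mul_one, norm_div, norm_mul]
      calc _ ≤ (K + K) / (‖ζ‖ / 2 * (‖ζ‖ / 2)) := by
            gcongr
            exact (norm_sub_le _ _).trans (add_le_add (hK ζ hζ) (hK z hz.le))
        _ = _ := by field_simp; ring)
  simp_rw [hGt] at hzero
  rw [integral_const_mul] at hzero
  have hpi : ((Real.pi / z.im : ℝ) : ℂ) ≠ 0 := by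
    rw [ofReal_ne_zero]; have := Real.pi_pos; positivity
  have h := (mul_eq_zero.1 hzero).resolve_left hpi
  simp_rw [smul_sub] at h
  rwa [integral_sub hPf hPc, integral_smul_const, integral_poissonKernelUHP hz, one_smul,
    sub_eq_zero] at h

/-! ### Boundary functions by weak compactness -/

/-- The finite measure `dt / (1 + t²)` on the real line. -/
noncomputable def cauchyWeight : Measure ℝ :=
  volume.withDensity fun t => ENNReal.ofReal (1 / (1 + t ^ 2))

instance : IsFiniteMeasure cauchyWeight :=
  isFiniteMeasure_withDensity (lintegral_weight_ne_top integrable_one_div_one_add_sq)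

lemma measurable_weight : Measurable fun t : ℝ => ENNReal.ofReal (1 / (1 + t ^ 2)) := by
  fun_prop

lemma toReal_weight (t : ℝ) : (ENNReal.ofReal (1 / (1 + t ^ 2))).toReal = 1 / (1 + t ^ 2) :=
  ENNReal.toReal_ofReal (by positivity)

lemma integral_cauchyWeight (g : ℝ → ℂ) :
    ∫ t, g t ∂cauchyWeight = ∫ t : ℝ, (1 / (1 + t ^ 2)) • g t := by
  rw [cauchyWeight, integral_withDensity_eq_integral_toReal_smul₀ measurable_weight.aemeasurable
    (ae_of_all _ fun t => ENNReal.ofReal_lt_top)]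
  simp only [toReal_weight]

lemma integrable_cauchyWeight_iff (g : ℝ → ℂ) :
    Integrable g cauchyWeight ↔ Integrable fun t : ℝ => (1 / (1 + t ^ 2)) • g t := by
  rw [cauchyWeight, integrable_withDensity_iff_integrable_smul₀' measurable_weight.aemeasurable
    (ae_of_all _ fun t => ENNReal.ofReal_lt_top)]
  simp only [toReal_weight]

/-- The factor `1 + t²` cancels the density of `cauchyWeight`, so that Poisson integrals become L²
inner products. -/
lemma memLp_poissonKernelUHP_mul {y : ℝ} (hy : 0 < y) (x : ℝ) :
    MemLp (fun t : ℝ => ((poissonKernelUHP y (x - t) * (1 + t ^ 2) : ℝ) : ℂ)) 2 cauchyWeight := by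
  have hc := continuous_poissonKernelUHP hy x
  refine MemLp.of_bound (by fun_prop) (y * ((1 + 2 * x ^ 2) / y ^ 2 + 2))
    (ae_of_all _ fun t => ?_)
  rw [norm_real, Real.norm_of_nonneg (mul_nonneg (poissonKernelUHP_nonneg hy _) (by positivity)),
    ← le_div_iff₀ (by positivity), ← mul_one_div]
  exact poissonKernelUHP_le_weight hy hy x t (by nlinarith [sq_nonneg (x - t)])

lemma inner_poissonKernelUHP {y : ℝ} (hy : 0 < y) (x : ℝ) (v : Lp ℂ 2 cauchyWeight) {g : ℝ → ℂ}
    (hg : v =ᵐ[cauchyWeight] g) :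
    inner ℂ ((memLp_poissonKernelUHP_mul hy x).toLp _) v =
      ∫ t, poissonKernelUHP y (x - t) • g t := by
  rw [L2.inner_def, integral_congr_ae (g := fun t =>
    ((poissonKernelUHP y (x - t) * (1 + t ^ 2) : ℝ) : ℂ) * g t), integral_cauchyWeight]
  · congr 1 with t
    have : (1 + (t : ℂ) ^ 2) ≠ 0 := by
      have : ((1 + t ^ 2 : ℝ) : ℂ) ≠ 0 := by rw [ofReal_ne_zero]; positivity
      simpa using this
    simp only [real_smul]
    push_cast
    field_simp
  · filter_upwards [hg, (memLp_poissonKernelUHP_mul hy x).coeFn_toLp] with t h1 h2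
    rw [h1, h2, RCLike.inner_apply, conj_ofReal, mul_comm]

/-- A bounded holomorphic function on the upper half-plane is the Poisson integral of a function
on the real line. -/
lemma exists_poisson_smul_eq {f : ℂ → ℂ} (hf : DifferentiableOn ℂ f {z | 0 < z.im}) {K : ℝ}
    (hK : ∀ z : ℂ, 0 < z.im → ‖f z‖ ≤ K) :
    ∃ u : ℝ → ℂ, Integrable (fun t : ℝ => (1 / (1 + t ^ 2)) • u t) ∧
      ∀ z : ℂ, 0 < z.im → ∫ t, poissonKernelUHP z.im (z.re - t) • u t = f z := by
  have hpos : ∀ n : ℕ, (0 : ℝ) < 1 / (n + 1) := fun n => Nat.one_div_pos_of_nat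
  -- The upward shift makes `f ∘ s n` holomorphic across the real line, where the Poisson formula is
  -- known.
  set s : ℕ → ℂ → ℂ := fun n z => z + ((1 / (n + 1) : ℝ) : ℂ) * I with hs
  have him : ∀ n z, (s n z).im = z.im + 1 / (n + 1) := by
    intro n z; rw [hs, add_im, im_ofReal_mul, I_im, mul_one]
  have hdiff : ∀ n, DifferentiableOn ℂ (fun z => f (s n z)) {z | -(1 / (n + 1) : ℝ) < z.im} :=
    fun n => hf.comp (by fun_prop) fun z hz => by
      rw [Set.mem_ofPred_eq] at hz ⊢; rw [him]; linarith
  have hbdd : ∀ n z, 0 ≤ z.im → ‖f (s n z)‖ ≤ K := fun n z hz =>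
    hK _ (by rw [him]; linarith [hpos n])
  have hcont : ∀ n, Continuous fun t : ℝ => f (s n t) := fun n =>
    continuousOn_univ.1 ((hdiff n).continuousOn.comp continuous_ofReal.continuousOn
      fun t _ => by have := hpos n; rw [Set.mem_ofPred_eq, ofReal_im]; linarith)
  have hrep : ∀ n (z : ℂ), 0 < z.im →
      ∫ t : ℝ, poissonKernelUHP z.im (z.re - t) • f (s n t) = f (s n z) := fun n z hz =>
    integral_poissonKernelUHP_smul_of_bounded (f := fun z => f (s n z))
      (isOpen_lt continuous_const continuous_im)
      (fun z (hz : 0 ≤ z.im) => by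
        have := hpos n; rw [Set.mem_ofPred_eq]; linarith) (hdiff n) (hbdd n) hz
  have hmem : ∀ n, MemLp (fun t : ℝ => f (s n t)) 2 cauchyWeight := fun n =>
    MemLp.of_bound (hcont n).aestronglyMeasurable K (ae_of_all _ fun t => hbdd n t (by simp))
  set v : ℕ → Lp ℂ 2 cauchyWeight := fun n => (hmem n).toLp _ with hv
  obtain ⟨R, hR⟩ : ∃ R, ∀ n, ‖v n‖ ≤ R := by
    refine ⟨_, fun n => Lp.norm_le_of_ae_bound
      ((norm_nonneg _).trans (hK I (by simp))) ?_⟩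
    filter_upwards [(hmem n).coeFn_toLp] with t ht
    rw [ht]
    exact hbdd n t (by simp)
  set L : ℕ → WeakDual ℂ (Lp ℂ 2 cauchyWeight) := fun n =>
    StrongDual.toWeakDual (InnerProductSpace.toDual ℂ _ (v n)) with hL
  -- Banach–Alaoglu along an ultrafilter, which avoids extracting a subsequence.
  obtain ⟨Λ, -, hΛ⟩ := (WeakDual.isCompact_closedBall (𝕜 := ℂ)
    (0 : StrongDual ℂ (Lp ℂ 2 cauchyWeight)) R).ultrafilter_le_nhds'
    ((hyperfilter ℕ).map L) (by
      refine Ultrafilter.mem_map.2 (univ_mem' fun n => ?_)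
      change InnerProductSpace.toDual ℂ _ (v n) ∈ Metric.closedBall 0 R
      rw [mem_closedBall_zero_iff, LinearIsometryEquiv.norm_map]
      exact hR n)
  have hΛ' : Tendsto L (hyperfilter ℕ) (𝓝 Λ) := hΛ
  set w : Lp ℂ 2 cauchyWeight :=
    (InnerProductSpace.toDual ℂ _).symm (WeakDual.toStrongDual Λ) with hw
  refine ⟨w, (integrable_cauchyWeight_iff _).1 ((Lp.memLp w).integrable one_le_two),
    fun z hz => ?_⟩
  rw [← inner_poissonKernelUHP hz z.re w EventuallyEq.rfl]
  set k := (memLp_poissonKernelUHP_mul hz z.re).toLp _ with hk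
  have h1 : Tendsto (fun n => inner ℂ (v n) k) (hyperfilter ℕ) (𝓝 (inner ℂ w k)) := by
    have := ((WeakDual.eval_continuous k).tendsto Λ).comp hΛ'
    refine this.congr' (Eventually.of_forall fun n => ?_) |>.trans (le_of_eq ?_)
    · exact InnerProductSpace.toDual_apply_apply
    · rw [hw, InnerProductSpace.toDual_symm_apply]; rfl
  have h2 : Tendsto (fun n => inner ℂ k (v n)) (hyperfilter ℕ) (𝓝 (inner ℂ k w)) := by
    have := (Complex.continuous_conj.tendsto _).comp h1
    rw [inner_conj_symm] at this
    exact this.congr fun n => inner_conj_symm _ _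
  have h3 : Tendsto (fun n => f (s n z)) atTop (𝓝 (f z)) := by
    have hfc : ContinuousAt f z := (hf.differentiableAt
      ((isOpen_lt continuous_const continuous_im).mem_nhds hz)).continuousAt
    refine hfc.tendsto.comp ?_
    have h : Tendsto (fun n : ℕ => ((1 / (n + 1) : ℝ) : ℂ)) atTop (𝓝 ((0 : ℝ) : ℂ)) :=
      (continuous_ofReal.tendsto _).comp tendsto_one_div_add_atTop_nhds_zero_nat
    simpa [hs] using (h.mul_const I).const_add z
  refine tendsto_nhds_unique h2 ((h3.mono_left Nat.hyperfilter_le_atTop).congr fun n => ?_)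
  rw [hk, inner_poissonKernelUHP hz z.re (v n) (hmem n).coeFn_toLp, hrep n z hz]

lemma nhdsWithin_boundaryCone_neBot (x : ℝ) {M : ℝ} (hM : 0 < M) :
    (𝓝[boundaryCone x M] (x : ℂ)).NeBot := by
  have h : Tendsto (fun y : ℝ => (x : ℂ) + y * I) (𝓝[>] 0) (𝓝[boundaryCone x M] (x : ℂ)) := by
    refine tendsto_nhdsWithin_iff.2 ⟨?_, ?_⟩
    · exact (Continuous.tendsto' (by fun_prop) _ _ (by simp)).mono_left nhdsWithin_le_nhds
    · filter_upwards [self_mem_nhdsWithin] with y hy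
      rw [Set.mem_Ioi] at hy
      exact ⟨by simpa using hy, by simpa using mul_pos hM hy⟩
  exact h.neBot

lemma HasNontangentialLimit.unique {f : ℂ → ℂ} {x : ℝ} {a b : ℂ}
    (ha : HasNontangentialLimit f x a) (hb : HasNontangentialLimit f x b) : a = b :=
  haveI := nhdsWithin_boundaryCone_neBot x one_pos
  tendsto_nhds_unique (ha 1 one_pos) (hb 1 one_pos)

/-- **Fatou's theorem** for bounded holomorphic functions on the upper half-plane. -/
lemma exists_poisson_boundary_function {f : ℂ → ℂ} (hf : DifferentiableOn ℂ f {z | 0 < z.im})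
    {K : ℝ} (hK : ∀ z : ℂ, 0 < z.im → ‖f z‖ ≤ K) :
    ∃ u : ℝ → ℂ, Integrable (fun t : ℝ => (1 / (1 + t ^ 2)) • u t) ∧
      (∀ z : ℂ, 0 < z.im → ∫ t, poissonKernelUHP z.im (z.re - t) • u t = f z) ∧
      ∀ᵐ x : ℝ, HasNontangentialLimit f x (u x) := by
  obtain ⟨u, hu, hrep⟩ := exists_poisson_smul_eq hf hK
  refine ⟨u, hu, hrep, ?_⟩
  filter_upwards [ae_tendsto_poisson_smul hu] with x hx M _
  refine (hx M).congr' ?_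
  filter_upwards [self_mem_nhdsWithin] with z hz using hrep z hz.1

/-! ### Holomorphic functions with positive real part -/

lemma normSq_one_add_real_mul (δ : ℝ) (w : ℂ) :
    ‖1 + (δ : ℂ) * w‖ ^ 2 = 1 + 2 * δ * w.re + δ ^ 2 * ‖w‖ ^ 2 := by
  rw [← normSq_eq_norm_sq, ← normSq_eq_norm_sq, normSq_apply, normSq_apply]
  simp
  ring

lemma one_le_norm_one_add_real_mul {δ : ℝ} (hδ : 0 ≤ δ) {w : ℂ} (hw : 0 ≤ w.re) :
    1 ≤ ‖1 + (δ : ℂ) * w‖ := by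
  refine le_of_pow_le_pow_left₀ two_ne_zero (norm_nonneg _) ?_
  rw [normSq_one_add_real_mul]
  nlinarith [mul_nonneg hδ hw, sq_nonneg (δ * ‖w‖)]

lemma mul_norm_le_norm_one_add_real_mul {δ : ℝ} (hδ : 0 ≤ δ) {w : ℂ} (hw : 0 ≤ w.re) :
    δ * ‖w‖ ≤ ‖1 + (δ : ℂ) * w‖ := by
  refine le_of_pow_le_pow_left₀ two_ne_zero (norm_nonneg _) ?_
  rw [normSq_one_add_real_mul]
  nlinarith [mul_nonneg hδ hw]

/-- For `w ≠ 0` the quotient is `1 / (1 / w + δ)`, and inversion and translation by `δ` preserve the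
closed right half-plane. -/
lemma re_div_one_add_real_mul_nonneg {δ : ℝ} (hδ : 0 ≤ δ) {w : ℂ} (hw : 0 ≤ w.re) :
    0 ≤ (w / (1 + (δ : ℂ) * w)).re := by
  rw [div_re, ← add_div]
  refine div_nonneg ?_ (normSq_nonneg _)
  simp
  nlinarith [mul_nonneg hδ (sq_nonneg w.re), mul_nonneg hδ (sq_nonneg w.im)]

/-- The Cayley transform of a holomorphic function with positive real part takes the boundary
value `1` only on a null set. -/
lemma ae_cayley_boundary_ne_one {h : ℂ → ℂ} (hh : DifferentiableOn ℂ h {z | 0 < z.im})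
    (hre : ∀ z : ℂ, 0 < z.im → 0 < (h z).re) {u : ℝ → ℂ} (hu : AEStronglyMeasurable u)
    (hlim : ∀ᵐ x : ℝ, HasNontangentialLimit (fun z => (h z - 1) / (h z + 1)) x (u x)) :
    ∀ᵐ x : ℝ, u x ≠ 1 := by
  set P : ℝ → ℝ := fun t => poissonKernelUHP 1 (0 - t) with hP
  set E : Set ℝ := {x | u x = 1} with hE
  have hEm : NullMeasurableSet E :=
    hu.nullMeasurableSet_eq_fun aestronglyMeasurable_const
  have hPint : Integrable P := integrable_poissonKernelUHP integrable_one_div_one_add_sq one_pos 0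
  have hPpos : ∀ t, 0 < P t := fun t => by
    rw [hP]; unfold poissonKernelUHP; have := Real.pi_pos; positivity
  have hbound : ∀ n : ℕ, ∫ t, E.indicator P t ≤ ‖h I‖ / (n + 1) := by
    intro n
    set δ : ℝ := 1 / (n + 1) with hδdef
    have hδ : 0 < δ := Nat.one_div_pos_of_nat
    have hδ0 : (δ : ℂ) ≠ 0 := ofReal_ne_zero.2 hδ.ne'
    have hne : ∀ z : ℂ, 0 < z.im → 1 + (δ : ℂ) * h z ≠ 0 := fun z hz =>
      norm_pos_iff.1 (one_pos.trans_le (one_le_norm_one_add_real_mul hδ.le (hre z hz).le))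
    -- A truncation of `h`, bounded by `1 / δ`, with boundary value `1 / δ` almost everywhere on
    -- `E`. Its Poisson formula at `I` gives `∫ E.indicator P ≤ δ * (b I).re ≤ δ * ‖h I‖`.
    set b : ℂ → ℂ := fun z => h z / (1 + (δ : ℂ) * h z) with hb
    have hbd : DifferentiableOn ℂ b {z | 0 < z.im} :=
      hh.div ((hh.const_mul _).const_add _) hne
    obtain ⟨v, hv, hrep, hvlim⟩ := exists_poisson_boundary_function hbd (K := 1 / δ)
      (fun z hz => by
        rw [hb, norm_div, div_le_div_iff₀ (norm_pos_iff.2 (hne z hz)) hδ, one_mul, mul_comm]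
        exact mul_norm_le_norm_one_add_real_mul hδ.le (hre z hz).le)
    have hvre : ∀ᵐ x : ℝ, E.indicator P x ≤ δ * (P x • v x).re := by
      filter_upwards [hvlim, hlim] with x hx hux
      have hnn : 0 ≤ (v x).re := by
        have := nhdsWithin_boundaryCone_neBot x one_pos
        refine ge_of_tendsto ((continuous_re.tendsto _).comp (hx 1 one_pos)) ?_
        filter_upwards [self_mem_nhdsWithin] with z hz
        exact re_div_one_add_real_mul_nonneg hδ.le (hre z hz.1).le
      rw [real_smul, re_ofReal_mul]
      by_cases hxE : x ∈ E
      · have hx1 : u x = 1 := hxE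
        have hvx : v x = 1 / δ := by
          refine hx.unique fun M hM => ?_
          have hf := hux M hM
          rw [hx1] at hf
          -- In terms of the Cayley transform `f` of `h`, `b = (1 + f) / ((1 - f) + δ (1 + f))`,
          -- which is continuous at `f = 1`.
          have h1 := (hf.const_add 1).div ((hf.const_sub 1).add ((hf.const_add 1).const_mul (δ : ℂ)))
            (by simp [hδ0])
          have h2 : ((1 : ℂ) + 1) / (1 - 1 + δ * (1 + 1)) = 1 / δ := by field_simp; norm_num
          rw [h2] at h1
          refine h1.congr' ?_
          filter_upwards [self_mem_nhdsWithin] with z hz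
          have h3 : h z + 1 ≠ 0 := fun h0 => by
            have := congrArg re h0
            rw [add_re, one_re, zero_re] at this
            linarith [hre z hz.1]
          have h4 := hne z hz.1
          have h5 : 1 - (h z - 1) / (h z + 1) + δ * (1 + (h z - 1) / (h z + 1)) =
              2 * (1 + δ * h z) / (h z + 1) := by field_simp; ring
          have h6 : 1 + (h z - 1) / (h z + 1) = 2 * h z / (h z + 1) := by field_simp; ring
          rw [Pi.div_apply, h5, h6, hb]
          field_simp
        rw [Set.indicator_of_mem hxE, hvx, ← ofReal_one, ← ofReal_div, ofReal_re]
        field_simp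
        exact le_rfl
      · rw [Set.indicator_of_notMem hxE]
        exact mul_nonneg hδ.le (mul_nonneg (hPpos x).le hnn)
    have hPv : Integrable fun t => P t • v t := integrable_poissonKernelUHP_smul hv one_pos 0
    have hI : ∫ t, P t • v t = b I := by simpa [hP] using hrep I (by simp)
    calc ∫ t, E.indicator P t ≤ ∫ t, δ * (P t • v t).re :=
          integral_mono_ae (hPint.indicator₀ hEm) (hPv.re.const_mul δ) hvre
      _ = δ * (b I).re := by
          have hre' : ∫ t, (P t • v t).re = (∫ t, P t • v t).re := integral_re hPv
          rw [integral_const_mul, hre', hI]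
      _ ≤ δ * ‖h I‖ := by
          refine mul_le_mul_of_nonneg_left ((re_le_norm _).trans ?_) hδ.le
          rw [hb, norm_div]
          exact div_le_self (norm_nonneg _)
            (one_le_norm_one_add_real_mul hδ.le (hre I (by simp)).le)
      _ = ‖h I‖ / (n + 1) := by rw [hδdef]; ring
  have hle : ∫ t, E.indicator P t ≤ 0 := by
    have h0 : Tendsto (fun n : ℕ => ‖h I‖ / ((n : ℝ) + 1)) atTop (𝓝 0) :=
      tendsto_const_nhds.div_atTop
        (tendsto_atTop_add_const_right _ _ tendsto_natCast_atTop_atTop)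
    exact ge_of_tendsto' h0 hbound
  have hnonneg : 0 ≤ E.indicator P := fun t => Set.indicator_nonneg (fun t _ => (hPpos t).le) t
  have hzero := (integral_eq_zero_iff_of_nonneg hnonneg (hPint.indicator₀ hEm)).1
    (le_antisymm hle (integral_nonneg hnonneg))
  filter_upwards [hzero] with x hx hx1
  rw [Set.indicator_of_mem (show x ∈ E from hx1)] at hx
  exact (hPpos x).ne' hx

/-- A holomorphic function with positive real part on the upper half-plane has finite
non-tangential limits almost everywhere. -/
lemma ae_exists_hasNontangentialLimit_of_re_pos {h : ℂ → ℂ}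
    (hh : DifferentiableOn ℂ h {z | 0 < z.im}) (hre : ∀ z : ℂ, 0 < z.im → 0 < (h z).re) :
    ∀ᵐ x : ℝ, ∃ w, HasNontangentialLimit h x w := by
  have hne : ∀ z : ℂ, 0 < z.im → h z + 1 ≠ 0 := fun z hz h0 => by
    have := congrArg re h0
    rw [add_re, one_re, zero_re] at this
    linarith [hre z hz]
  obtain ⟨u, hu, -, hlim⟩ := exists_poisson_boundary_function
    (f := fun z => (h z - 1) / (h z + 1)) (K := 1)
    ((hh.sub_const 1).div (hh.add_const 1) hne) (fun z hz => by
      rw [norm_div, div_le_one (norm_pos_iff.2 (hne z hz))]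
      refine le_of_pow_le_pow_left₀ two_ne_zero (norm_nonneg _) ?_
      rw [← normSq_eq_norm_sq, ← normSq_eq_norm_sq, normSq_apply, normSq_apply]
      simp only [sub_re, add_re, sub_im, add_im, one_re, one_im]
      nlinarith [hre z hz])
  filter_upwards [hlim, ae_cayley_boundary_ne_one hh hre
    (aestronglyMeasurable_of_integrable_weight_smul hu) hlim] with x hx hx1
  refine ⟨(1 + u x) / (1 - u x), fun M hM => ?_⟩
  refine (((hx M hM).const_add 1).div ((hx M hM).const_sub 1)
    (sub_ne_zero.2 hx1.symm)).congr' ?_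
  filter_upwards [self_mem_nhdsWithin] with z hz
  have h3 := hne z hz.1
  rw [Pi.div_apply]
  have h5 : 1 - (h z - 1) / (h z + 1) = 2 / (h z + 1) := by field_simp; ring
  have h6 : 1 + (h z - 1) / (h z + 1) = 2 * h z / (h z + 1) := by field_simp; ring
  rw [h5, h6]
  field_simp

/-! ### The Clark kernel and the conclusion -/

/-- The fraction without `I` is real. Hence the two cases of the theorem are one formula. -/
lemma clarkKernel_eq_zero_of_im_eq_zero (α : ℝ) {w : ℂ} (hw : w.im = 0) :
    clarkKernel α w = 0 := by
  obtain ⟨r, rfl⟩ : ∃ r : ℝ, w = r := ⟨w.re, Complex.ext rfl hw⟩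
  have : I * (1 + (α : ℂ) * r) / (r - α) = I * (((1 + α * r) / (r - α) : ℝ) : ℂ) := by
    push_cast; ring
  rw [clarkKernel, this]
  simp only [mul_re, I_re, I_im, ofReal_re, ofReal_im]
  ring

lemma continuousAt_clarkKernel {α : ℝ} {w : ℂ} (hw : w ≠ α) :
    ContinuousAt (clarkKernel α) w := by
  have h : w - (α : ℂ) ≠ 0 := sub_ne_zero.2 hw
  unfold clarkKernel
  refine continuousAt_const.mul (continuous_re.continuousAt.comp ?_)
  exact ContinuousAt.div (by fun_prop) (by fun_prop) h

theorem mainTheorem12 (φ : ℂ → ℂ)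
    (hφ : DifferentiableOn ℂ φ {z : ℂ | 0 < z.im})
    (hmaps : Set.MapsTo φ {z : ℂ | 0 < z.im} {z : ℂ | 0 < z.im})
    (α : ℝ) (μ : Measure ℝ) (c : ℝ) (hμ : IsAleksandrovClark φ α μ c) :
    μ.HaveLebesgueDecomposition volume ∧
    ∀ᵐ x : ℝ ∂volume,
      μ.rnDeriv volume x < ⊤ ∧
      ∃ w : ℂ, HasNontangentialLimit φ x w ∧
        (w.im ≠ 0 → (μ.rnDeriv volume x).toReal =
          (1 / (Real.pi * (1 + α ^ 2))) * (I * (1 + (α : ℂ) * w) / (w - (α : ℂ))).re) ∧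
        (w.im = 0 → (μ.rnDeriv volume x).toReal = 0) := by
  have := isLocallyFiniteMeasure_of_integrable_weight hμ.integrable
  refine ⟨inferInstance, ?_⟩
  have him : ∀ z : ℂ, 0 < z.im → 0 < (φ z).im := fun z hz => hmaps hz
  have hsub : ∀ z : ℂ, 0 < z.im → φ z - α ≠ 0 := fun z hz h0 => by
    have := congrArg im h0
    rw [sub_im, ofReal_im, sub_zero, zero_im] at this
    exact (him z hz).ne' this
  have h1 := ae_exists_hasNontangentialLimit_of_re_pos (h := fun z => -I * φ z)
    (hφ.const_mul _) (fun z hz => by simpa using him z hz)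
  have h2 := ae_exists_hasNontangentialLimit_of_re_pos (h := fun z => I / (φ z - α))
    ((differentiableOn_const _).div (hφ.sub_const _) hsub) (fun z hz => by
      have h := normSq_pos.2 (hsub z hz)
      have h' := him z hz
      rw [div_re]
      simp only [I_re, I_im, zero_mul, zero_div, zero_add, one_mul, sub_im, ofReal_im, sub_zero]
      positivity)
  filter_upwards [h1, h2, ae_tendsto_poisson_rnDeriv hμ.integrable,
    Measure.rnDeriv_lt_top μ volume] with x ⟨w₁, hw₁⟩ ⟨w₂, hw₂⟩ hx hlt
  have hw : HasNontangentialLimit φ x (I * w₁) := fun M hM =>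
    ((hw₁ M hM).const_mul I).congr fun z => by
      rw [← mul_assoc, mul_neg, I_mul_I, neg_neg, one_mul]
  have hcone := nhdsWithin_boundaryCone_neBot x one_pos
  -- If `φ` tended to `α`, the product of `I / (φ - α)`, which has a finite limit, and `φ - α` would
  -- tend to 0; but it is constantly `I`.
  have hwα : I * w₁ ≠ α := by
    intro h
    have h3 := (hw₂ 1 one_pos).mul ((hw 1 one_pos).sub_const (α : ℂ))
    rw [h, sub_self, mul_zero] at h3
    refine I_ne_zero (tendsto_nhds_unique (tendsto_const_nhds.congr' ?_) h3)
    filter_upwards [self_mem_nhdsWithin] with z hz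
    rw [div_mul_cancel₀ _ (hsub z hz.1)]
  have heq : (μ.rnDeriv volume x).toReal = clarkKernel α (I * w₁) := by
    have h3 : Tendsto (fun z : ℂ => c * z.im + ∫ t, poissonKernelUHP z.im (z.re - t) ∂μ)
        (𝓝[boundaryCone x 1] (x : ℂ)) (𝓝 (0 + (μ.rnDeriv volume x).toReal)) :=
      (Continuous.tendsto' (by fun_prop) _ _ (by simp) |>.mono_left nhdsWithin_le_nhds).add (hx 1)
    rw [zero_add] at h3
    refine tendsto_nhds_unique h3
      (((continuousAt_clarkKernel hwα).tendsto.comp (hw 1 one_pos)).congr' ?_)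
    filter_upwards [self_mem_nhdsWithin] with z hz
    rw [← hμ.herglotz z.re z.im hz.1, re_add_im, Function.comp_apply]
  exact ⟨hlt, I * w₁, hw, fun _ => heq,
    fun h0 => heq.trans (clarkKernel_eq_zero_of_im_eq_zero α h0)⟩
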